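/- Throughout, $\mathbf A$ is a real $n\times n$ matrix. For $\alpha,\beta\subseteq\{1,\dots,n\}$ with $|\alpha|=|\beta|=k\ge 1$, let $A\binom{\alpha}{\beta}$ denote the minor of $\mathbf A$ with row set $\alpha$ and column set $\beta$ (indices in increasing order). $\mathbf A$ is a $P$-matrix if $A\binom{\alpha}{\alpha}>0$ for all nonempty $\alpha$. It is a $Q$-matrix if $\sum_{|\alpha|=k}A\binom{\alpha}{\alpha}>0$ for all $1\le k\le n$, and a $Q^2$-matrix if both $\mathbf A$ and $\mathbf A^2$ are $Q$-matrices. It is strictly row square diagonally dominant for every order of minors if $$\left(A\binom{\alpha}{\alpha}\right)^2>\sum_{|\beta|=|\alpha|,\ \beta\ne\alpha}\left(A\binom{\alpha}{\beta}\right)^2$$ for every nonempty $\alpha\subseteq\{1,\dots,n\}$, and strictly column square diagonally dominant for every order of minors if $\mathbf A^T$ has this property. It is positively stable if all of its complex eigenvalues have positive real parts. Theorem. Let $\mathbf A$ be a $P$-matrix which is strictly row (or column) square diagonally dominant for every order of minors. Then $\mathbf A$ is positively stable. Moreover, every principal submatrix of $\mathbf A$ is again strictly row (respectively, column) square diagonally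 dominant for every order of minors, and $\mathbf A$ and all of its principal submatrices are $Q^2$-matrices. -/

import Mathlib

/-- The minor of `A` with row indices `α 0 < ⋯ < α (k - 1)` and column indices
`β 0 < ⋯ < β (k - 1)`. A set of `k` indices written in increasing order is a strictly
increasing map `Fin k ↪o Fin n`. -/
def minor {n k : ℕ} (A : Matrix (Fin n) (Fin n) ℝ) (α β : Fin k ↪o Fin n) : ℝ :=
  (A.submatrix α β).det

/-- The principal submatrix of `A` with row and column indices `α 0 < ⋯ < α (k - 1)`. -/
def principalSubmatrix {n k : ℕ} (A : Matrix (Fin n) (Fin n) ℝ) (α : Fin k ↪o Fin n) :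
    Matrix (Fin k) (Fin k) ℝ :=
  A.submatrix α α

/-- `P`-matrix: every principal minor is positive. -/
def IsPMatrix {n : ℕ} (A : Matrix (Fin n) (Fin n) ℝ) : Prop :=
  ∀ k : ℕ, 1 ≤ k → k ≤ n → ∀ α : Fin k ↪o Fin n, 0 < minor A α α

open Classical in
/-- `Q`-matrix: for each order `1 ≤ k ≤ n`, the sum of the principal minors of order `k`
is positive. -/
def IsQMatrix {n : ℕ} (A : Matrix (Fin n) (Fin n) ℝ) : Prop :=
  ∀ k : ℕ, 1 ≤ k → k ≤ n → 0 < ∑ α : Fin k ↪o Fin n, minor A α α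

/-- `Q²`-matrix: both `A` and `A²` are `Q`-matrices. -/
def IsQ2Matrix {n : ℕ} (A : Matrix (Fin n) (Fin n) ℝ) : Prop :=
  IsQMatrix A ∧ IsQMatrix (A ^ 2)

open Classical in
/-- Strict row square diagonal dominance for every order of minors: for every order
`1 ≤ k ≤ n` and every index set `α` of size `k`, the square of the principal minor on `α`
exceeds the sum of the squares of the other minors of order `k` with row set `α`. -/
def IsStrictlyRowSquareDiagDominant {n : ℕ} (A : Matrix (Fin n) (Fin n) ℝ) : Prop :=
  ∀ k : ℕ, 1 ≤ k → k ≤ n → ∀ α : Fin k ↪o Fin n,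
    ∑ β ∈ Finset.univ.filter (fun β : Fin k ↪o Fin n => β ≠ α), minor A α β ^ 2
      < minor A α α ^ 2

/-- Strict column square diagonal dominance for every order of minors. -/
def IsStrictlyColumnSquareDiagDominant {n : ℕ} (A : Matrix (Fin n) (Fin n) ℝ) : Prop :=
  IsStrictlyRowSquareDiagDominant A.transpose

/-- Positive stability: every complex eigenvalue has positive real part. -/
def IsPositivelyStable {n : ℕ} (A : Matrix (Fin n) (Fin n) ℝ) : Prop :=
  ∀ z : ℂ, Module.End.HasEigenvalue (Matrix.toLin' (A.map Complex.ofReal)) z → 0 < z.re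

/-! For each order `k`, the hypothesis puts every row of the `k`-th compound matrix in an open
convex cone around its diagonal entry (`IsRowLorentz`). Three facts carry the proof.

Squares: by Cauchy–Binet, the sum of the principal minors of `A ^ 2` is the trace of the squared
compound; the bound `ab ≥ -(a² + b²)/2` and dominance make it positive.

Shifts: `A + t • 1` with `t ≥ 0` stays in the class. Raising one diagonal entry adds to a compound
row a nonnegative multiple of a compound row of order one less, up to signs and zeros, and the cone
is convex.

Imaginary axis: an eigenvalue `iy` of `B` gives the eigenvalue `-y² ≤ 0` of `B ^ 2`, impossible for
a `Q`-matrix, whose characteristic polynomial has alternating coefficients. An eigenvalue of `A`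
with real part `-t ≤ 0` would become imaginary for `A + t • 1`.

The column case follows by transposition. -/

open Matrix Finset

/-! ### Cauchy–Binet and compounds of squares -/

section CauchyBinet

open Classical in
/-- A sum over all maps that vanishes off the injective ones is a sum over the pairs of an
increasing map and a permutation. -/
theorem sum_pi_eq_sum_orderEmbedding_perm {n k : ℕ} (f : (Fin k → Fin n) → ℝ)
    (hf : ∀ p, ¬ Function.Injective p → f p = 0) :
    ∑ p, f p = ∑ β : Fin k ↪o Fin n, ∑ σ : Equiv.Perm (Fin k), f (β ∘ σ) := by
  rw [← Finset.sum_product', Finset.univ_product_univ]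
  symm
  apply Finset.sum_of_injOn (fun x : (Fin k ↪o Fin n) × Equiv.Perm (Fin k) => x.1 ∘ x.2)
  · rintro ⟨β, σ⟩ - ⟨β', σ'⟩ - h
    have hβ : β = β' := by
      rw [← OrderEmbedding.range_inj]
      have := congrArg Set.range h
      simpa [Set.range_comp] using this
    subst hβ
    have : σ = σ' := by
      ext i : 1
      exact β.injective (congrFun h i)
    rw [this]
  · simp
  · intro p _ hp
    apply hf
    intro hinj
    apply hp
    have hmono : StrictMono (p ∘ Tuple.sort p) :=
      (Tuple.monotone_sort p).strictMono_of_injective (hinj.comp (Tuple.sort p).injective)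
    refine ⟨(OrderEmbedding.ofStrictMono _ hmono, (Tuple.sort p)⁻¹), by simp, ?_⟩
    ext i
    simp
  · simp

open Classical in
/-- The **Cauchy–Binet formula**. -/
theorem det_mul_eq_sum_orderEmbedding {n k : ℕ} (M : Matrix (Fin k) (Fin n) ℝ)
    (N : Matrix (Fin n) (Fin k) ℝ) :
    (M * N).det = ∑ β : Fin k ↪o Fin n, (M.submatrix id β).det * (N.submatrix β id).det := by
  have h1 : (M * N).det = ∑ p : Fin k → Fin n, (∏ i, M i (p i)) * (N.submatrix p id).det := by
    have hrow : (M * N) = Matrix.of fun i => ∑ j, M i j • N j := by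
      ext i l
      simp [Matrix.mul_apply]
    rw [hrow]
    change detRowAlternating.toMultilinearMap (fun i => ∑ j, M i j • N j) = _
    rw [MultilinearMap.map_sum]
    refine Finset.sum_congr rfl fun p _ => ?_
    rw [MultilinearMap.map_smul_univ]
    rfl
  rw [h1, sum_pi_eq_sum_orderEmbedding_perm]
  · refine Finset.sum_congr rfl fun β _ => ?_
    rw [← det_transpose (M.submatrix id β), det_apply', Finset.sum_mul]
    refine Finset.sum_congr rfl fun σ _ => ?_
    have := det_permute σ (N.submatrix β id)
    rw [submatrix_submatrix] at this
    simp only [Function.comp_id] at this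
    rw [this]
    simp
    ring
  · intro p hp
    simp only [Function.Injective, not_forall] at hp
    obtain ⟨i, j, hij, hne⟩ := hp
    rw [det_zero_of_row_eq hne, mul_zero]
    ext l
    simp [hij]

open Classical in
theorem minor_sq {n k : ℕ} (A : Matrix (Fin n) (Fin n) ℝ) (α γ : Fin k ↪o Fin n) :
    minor (A ^ 2) α γ = ∑ β : Fin k ↪o Fin n, minor A α β * minor A β γ := by
  have h : (A ^ 2).submatrix α γ = A.submatrix α id * A.submatrix id γ := by
    rw [pow_two, submatrix_mul _ _ α id γ Function.bijective_id]
  rw [minor, h, det_mul_eq_sum_orderEmbedding]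
  rfl

end CauchyBinet

/-! ### Transposes, the cone condition and `Q²` -/

theorem minor_transpose {n k : ℕ} (A : Matrix (Fin n) (Fin n) ℝ) (α β : Fin k ↪o Fin n) :
    minor Aᵀ α β = minor A β α := by
  rw [minor, minor, ← det_transpose, transpose_submatrix, transpose_transpose]

theorem minor_principalSubmatrix {n m k : ℕ} (A : Matrix (Fin n) (Fin n) ℝ)
    (γ : Fin m ↪o Fin n) (α β : Fin k ↪o Fin m) :
    minor (principalSubmatrix A γ) α β = minor A (α.trans γ) (β.trans γ) := rfl

theorem IsPMatrix.transpose {n : ℕ} {A : Matrix (Fin n) (Fin n) ℝ} (hA : IsPMatrix A) :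
    IsPMatrix Aᵀ := fun k hk hkn α => by
  rw [minor_transpose]
  exact hA k hk hkn α

theorem isQMatrix_transpose {n : ℕ} {A : Matrix (Fin n) (Fin n) ℝ} :
    IsQMatrix Aᵀ ↔ IsQMatrix A := by
  simp only [IsQMatrix, minor_transpose]

theorem isQ2Matrix_transpose {n : ℕ} {A : Matrix (Fin n) (Fin n) ℝ} :
    IsQ2Matrix Aᵀ ↔ IsQ2Matrix A := by
  rw [IsQ2Matrix, IsQ2Matrix, ← transpose_pow, isQMatrix_transpose, isQMatrix_transpose]

theorem isPositivelyStable_transpose {n : ℕ} {A : Matrix (Fin n) (Fin n) ℝ} :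
    IsPositivelyStable Aᵀ ↔ IsPositivelyStable A := by
  have h : Aᵀ.map Complex.ofReal = (A.map Complex.ofReal)ᵀ := transpose_map
  simp only [IsPositivelyStable, Module.End.hasEigenvalue_iff_isRoot_charpoly,
    charpoly_toLin', h, charpoly_transpose]

open Classical in
/-- Every row of every compound of `A` lies in the open Lorentz-type cone
`0 < x α`, `∑ β, x β ^ 2 < 2 * x α ^ 2` around its diagonal entry. -/
def IsRowLorentz {n : ℕ} (A : Matrix (Fin n) (Fin n) ℝ) : Prop :=
  ∀ (k : ℕ) (α : Fin k ↪o Fin n),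
    0 < minor A α α ∧ ∑ β : Fin k ↪o Fin n, minor A α β ^ 2 < 2 * minor A α α ^ 2

theorem minor_fin_zero {n : ℕ} (A : Matrix (Fin n) (Fin n) ℝ) (α β : Fin 0 ↪o Fin n) :
    minor A α β = 1 := by
  simp [minor]

theorem isRowLorentz_iff {n : ℕ} {A : Matrix (Fin n) (Fin n) ℝ} :
    IsRowLorentz A ↔ IsPMatrix A ∧ IsStrictlyRowSquareDiagDominant A := by
  classical
  have key : ∀ (k : ℕ) (α : Fin k ↪o Fin n),
      ∑ β : Fin k ↪o Fin n, minor A α β ^ 2 =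
        ∑ β ∈ Finset.univ.filter (fun β : Fin k ↪o Fin n => β ≠ α), minor A α β ^ 2
          + minor A α α ^ 2 := by
    intro k α
    rw [← Finset.sum_erase_add _ _ (Finset.mem_univ α), Finset.filter_ne']
  constructor
  · intro h
    refine ⟨fun k _ _ α => (h k α).1, fun k _ _ α => ?_⟩
    have h2 := (h k α).2
    rw [key] at h2
    convert (by linarith : ∑ β ∈ Finset.univ.filter (fun β : Fin k ↪o Fin n => β ≠ α),
      minor A α β ^ 2 < minor A α α ^ 2)
  · rintro ⟨hP, hR⟩ k α
    have hkn : k ≤ n := by simpa using Fintype.card_le_of_injective α α.injective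
    rcases Nat.eq_zero_or_pos k with rfl | hk
    · have hsub : Subsingleton (Fin 0 ↪o Fin n) := ⟨fun β γ => RelEmbedding.ext fun i => i.elim0⟩
      -- At order zero all minors are 1 and there is one empty index map, so the claim is `1 < 2`.
      simpa [minor_fin_zero] using
        lt_of_le_of_lt (Fintype.card_le_one_iff_subsingleton.2 hsub) one_lt_two
    · refine ⟨hP k hk hkn α, ?_⟩
      rw [key]
      have := hR k hk hkn α
      linarith

/-- Minors of a principal submatrix are minors of `A`; restricting the columns only drops squares
from the sum. -/
theorem IsRowLorentz.principalSubmatrix {n m : ℕ} {A : Matrix (Fin n) (Fin n) ℝ}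
    (hA : IsRowLorentz A) (γ : Fin m ↪o Fin n) : IsRowLorentz (principalSubmatrix A γ) := by
  classical
  intro k α
  simp only [minor_principalSubmatrix]
  refine ⟨(hA k _).1, lt_of_le_of_lt ?_ (hA k _).2⟩
  have hinj : Function.Injective (fun β : Fin k ↪o Fin m => β.trans γ) := fun β β' h => by
    ext i : 1
    exact γ.injective (DFunLike.congr_fun h i)
  rw [← Finset.sum_image (s := Finset.univ) (g := fun β : Fin k ↪o Fin m => β.trans γ)
    (f := fun β => minor A (α.trans γ) β ^ 2) hinj.injOn]
  exact Finset.sum_le_sum_of_subset_of_nonneg (Finset.subset_univ _) fun _ _ _ => sq_nonneg _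

theorem IsRowLorentz.isQMatrix {n : ℕ} {A : Matrix (Fin n) (Fin n) ℝ} (hA : IsRowLorentz A) :
    IsQMatrix A := by
  intro k _ hk
  exact Finset.sum_pos (fun α _ => (hA k α).1) ⟨Fin.castLEOrderEmb hk, Finset.mem_univ _⟩

theorem IsRowLorentz.isQMatrix_sq {n : ℕ} {A : Matrix (Fin n) (Fin n) ℝ}
    (hA : IsRowLorentz A) : IsQMatrix (A ^ 2) := by
  classical
  intro k _ hk
  -- The 2 leaves exactly `minor A α α ^ 2` on the diagonal and makes the total in `h2` a sum of row
  -- gaps.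
  have h1 : ∀ α β : Fin k ↪o Fin n, (if α = β then 2 * minor A α α ^ 2 else 0)
      - (minor A α β ^ 2 + minor A β α ^ 2) / 2 ≤ minor A α β * minor A β α := by
    intro α β
    split_ifs with h
    · subst h
      nlinarith
    · nlinarith [sq_nonneg (minor A α β + minor A β α)]
  have h2 : ∑ α : Fin k ↪o Fin n, ∑ β : Fin k ↪o Fin n,
      ((if α = β then 2 * minor A α α ^ 2 else 0) - (minor A α β ^ 2 + minor A β α ^ 2) / 2)
      = ∑ α : Fin k ↪o Fin n, (2 * minor A α α ^ 2 - ∑ β : Fin k ↪o Fin n, minor A α β ^ 2) := by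
    simp only [Finset.sum_sub_distrib, ← Finset.sum_div, Finset.sum_add_distrib]
    rw [Finset.sum_comm (f := fun α β : Fin k ↪o Fin n => minor A β α ^ 2)]
    simp
  calc (0 : ℝ) < ∑ α : Fin k ↪o Fin n,
        (2 * minor A α α ^ 2 - ∑ β : Fin k ↪o Fin n, minor A α β ^ 2) :=
        Finset.sum_pos (fun α _ => sub_pos.2 (hA k α).2)
          ⟨Fin.castLEOrderEmb hk, Finset.mem_univ _⟩
    _ ≤ ∑ α : Fin k ↪o Fin n, ∑ β : Fin k ↪o Fin n, minor A α β * minor A β α := by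
        rw [← h2]
        exact Finset.sum_le_sum fun α _ => Finset.sum_le_sum fun β _ => h1 α β
    _ = ∑ α : Fin k ↪o Fin n, minor (A ^ 2) α α := by simp only [minor_sq]

theorem IsRowLorentz.isQ2Matrix {n : ℕ} {A : Matrix (Fin n) (Fin n) ℝ}
    (hA : IsRowLorentz A) : IsQ2Matrix A :=
  ⟨hA.isQMatrix, hA.isQMatrix_sq⟩

/-! ### Invariance under nonnegative diagonal shifts -/

section Shift

/-- The cone `0 < x a`, `∑ x ^ 2 < 2 * x a ^ 2` is closed under `x + t • y`, `0 ≤ t`. -/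
theorem lorentz_add_smul {ι : Type*} [Fintype ι] {x y : ι → ℝ} {a : ι} {t : ℝ} (ht : 0 ≤ t)
    (hx : 0 < x a ∧ ∑ b, x b ^ 2 < 2 * x a ^ 2) (hy : 0 < y a ∧ ∑ b, y b ^ 2 < 2 * y a ^ 2) :
    0 < x a + t * y a ∧ ∑ b, (x b + t * y b) ^ 2 < 2 * (x a + t * y a) ^ 2 := by
  obtain ⟨hx0, hx⟩ := hx
  obtain ⟨hy0, hy⟩ := hy
  refine ⟨by positivity, ?_⟩
  -- Cauchy–Schwarz bounds the cross term, as in convexity of the Lorentz cone.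
  have hxy : ∑ b, x b * y b < 2 * x a * y a := by
    apply lt_of_pow_lt_pow_left₀ 2 (by positivity)
    calc (∑ b, x b * y b) ^ 2 ≤ (∑ b, x b ^ 2) * ∑ b, y b ^ 2 :=
          Finset.sum_mul_sq_le_sq_mul_sq _ _ _
      _ < (2 * x a ^ 2) * (2 * y a ^ 2) :=
          mul_lt_mul'' hx hy (Finset.sum_nonneg fun _ _ => sq_nonneg _)
            (Finset.sum_nonneg fun _ _ => sq_nonneg _)
      _ = (2 * x a * y a) ^ 2 := by ring
  have hexp : ∑ b, (x b + t * y b) ^ 2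
      = ∑ b, x b ^ 2 + 2 * t * ∑ b, x b * y b + t ^ 2 * ∑ b, y b ^ 2 := by
    rw [Finset.mul_sum, Finset.mul_sum, ← Finset.sum_add_distrib, ← Finset.sum_add_distrib]
    exact Finset.sum_congr rfl fun b _ => by ring
  rw [hexp]
  nlinarith [mul_le_mul_of_nonneg_left hxy.le ht,
    mul_le_mul_of_nonneg_left hy.le (sq_nonneg t)]

/-- The increasing map obtained from `β` by omitting its `q`-th value. -/
def eraseIndex {n k : ℕ} (β : Fin (k + 1) ↪o Fin n) (q : Fin (k + 1)) : Fin k ↪o Fin n :=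
  q.succAboveOrderEmb.trans β

theorem range_eq_insert_eraseIndex {n k : ℕ} (β : Fin (k + 1) ↪o Fin n) (q : Fin (k + 1)) :
    Set.range β = insert (β q) (Set.range (eraseIndex β q)) := by
  have : (eraseIndex β q : Fin k → Fin n) = β ∘ q.succAbove := rfl
  rw [this, Set.range_comp, Fin.range_succAbove, ← Set.image_insert_eq, Set.insert_eq,
    Set.union_compl_self, Set.image_univ]

theorem submatrix_updateRow_of_injective {n k : ℕ} (A : Matrix (Fin n) (Fin n) ℝ)
    (α β : Fin k ↪o Fin n) (p : Fin k) (v : Fin n → ℝ) :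
    (A.updateRow (α p) v).submatrix α β = (A.submatrix α β).updateRow p (v ∘ β) := by
  ext i j
  simp [updateRow_apply, α.injective.eq_iff]

theorem minor_updateRow_of_notMem {n k : ℕ} (A : Matrix (Fin n) (Fin n) ℝ)
    (α β : Fin k ↪o Fin n) {i : Fin n} (hi : i ∉ Set.range α) (v : Fin n → ℝ) :
    minor (A.updateRow i v) α β = minor A α β := by
  have : (A.updateRow i v).submatrix α β = A.submatrix α β := by
    ext p q
    have : α p ≠ i := fun h => hi ⟨p, h⟩
    simp [updateRow_apply, this]
  rw [minor, minor, this]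

theorem minor_updateRow_add_smul {n k : ℕ} (A : Matrix (Fin n) (Fin n) ℝ)
    (α β : Fin k ↪o Fin n) (p : Fin k) (t : ℝ) (v : Fin n → ℝ) :
    minor (A.updateRow (α p) (A (α p) + t • v)) α β
      = minor A α β + t * minor (A.updateRow (α p) v) α β := by
  have h1 : (A (α p) + t • v) ∘ β = A (α p) ∘ β + t • (v ∘ β) := rfl
  have h2 : (A.submatrix α β).updateRow p (A (α p) ∘ β) = A.submatrix α β := by
    ext i j
    by_cases h : i = p <;> simp [updateRow_apply, h]
  simp only [minor, submatrix_updateRow_of_injective, h1, det_updateRow_add,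
    det_updateRow_smul, h2]

theorem minor_updateRow_single {n k : ℕ} (A : Matrix (Fin n) (Fin n) ℝ)
    (α β : Fin (k + 1) ↪o Fin n) (p q : Fin (k + 1)) (h : β q = α p) :
    minor (A.updateRow (α p) (Pi.single (α p) 1)) α β
      = (-1) ^ (p + q : ℕ) * minor A (eraseIndex α p) (eraseIndex β q) := by
  rw [minor, submatrix_updateRow_of_injective, det_succ_row _ p, Finset.sum_eq_single q]
  · rw [submatrix_updateRow_succAbove]
    simp [h, minor, eraseIndex, Function.comp_def]
  · intro j _ hj
    have : β j ≠ α p := fun h' => hj (β.injective (h'.trans h.symm))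
    simp [this]
  · simp

theorem minor_updateRow_single_of_notMem {n k : ℕ} (A : Matrix (Fin n) (Fin n) ℝ)
    (α β : Fin k ↪o Fin n) (p : Fin k) (h : α p ∉ Set.range β) :
    minor (A.updateRow (α p) (Pi.single (α p) 1)) α β = 0 := by
  rw [minor, submatrix_updateRow_of_injective]
  apply det_eq_zero_of_row_eq_zero p
  intro j
  have : β j ≠ α p := fun h' => h ⟨j, h'⟩
  simp [this]

/-- Expanding along the unit row leaves, up to sign, minors with row set `α` minus `α p`. Distinct
column sets containing `α p` stay distinct once it is removed, so the squares are among those of a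
row of the order `k` compound. -/
theorem IsRowLorentz.updateRow_single {n k : ℕ} {A : Matrix (Fin n) (Fin n) ℝ}
    (hA : IsRowLorentz A) (α : Fin (k + 1) ↪o Fin n) (p : Fin (k + 1)) :
    0 < minor (A.updateRow (α p) (Pi.single (α p) 1)) α α ∧
      ∑ β : Fin (k + 1) ↪o Fin n, minor (A.updateRow (α p) (Pi.single (α p) 1)) α β ^ 2
        < 2 * minor (A.updateRow (α p) (Pi.single (α p) 1)) α α ^ 2 := by
  classical
  have hdiag : minor (A.updateRow (α p) (Pi.single (α p) 1)) α α
      = minor A (eraseIndex α p) (eraseIndex α p) := by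
    rw [minor_updateRow_single A α α p p rfl, ← two_mul, pow_mul]
    simp
  rw [hdiag]
  obtain ⟨hpos, hsum⟩ := hA k (eraseIndex α p)
  refine ⟨hpos, lt_of_le_of_lt ?_ hsum⟩
  let S : Finset (Fin (k + 1) ↪o Fin n) := Finset.univ.filter fun β => α p ∈ Set.range β
  have hq : ∀ β : Fin (k + 1) ↪o Fin n, ∃ q, α p ∈ Set.range β → β q = α p := fun β => by
    by_cases h : α p ∈ Set.range β
    · obtain ⟨q, hq⟩ := h
      exact ⟨q, fun _ => hq⟩
    -- An arbitrary index: `q β` is used only for `β` in `S`.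
    · exact ⟨0, fun h' => absurd h' h⟩
  choose q hq using hq
  have hS : ∑ β : Fin (k + 1) ↪o Fin n,
      minor (A.updateRow (α p) (Pi.single (α p) 1)) α β ^ 2
      = ∑ β ∈ S, minor A (eraseIndex α p) (eraseIndex β (q β)) ^ 2 := by
    rw [← Finset.sum_subset (Finset.subset_univ S)]
    · refine Finset.sum_congr rfl fun β hβ => ?_
      rw [minor_updateRow_single A α β p (q β) (hq β (by simpa [S] using hβ)), mul_pow,
        ← pow_mul, mul_comm _ 2, pow_mul]
      simp
    · intro β _ hβ
      rw [minor_updateRow_single_of_notMem A α β p (by simpa [S] using hβ)]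
      simp
  have hinj : Set.InjOn (fun β : Fin (k + 1) ↪o Fin n => eraseIndex β (q β)) S := by
    intro β hβ β' hβ' h
    have h1 := hq β (by simpa [S] using hβ)
    have h2 := hq β' (by simpa [S] using hβ')
    rw [← OrderEmbedding.range_inj, range_eq_insert_eraseIndex β (q β),
      range_eq_insert_eraseIndex β' (q β'), h1, h2]
    simp only at h
    rw [h]
  rw [hS, ← Finset.sum_image (s := S)
    (g := fun β : Fin (k + 1) ↪o Fin n => eraseIndex β (q β))
    (f := fun β => minor A (eraseIndex α p) β ^ 2) hinj]
  exact Finset.sum_le_sum_of_subset_of_nonneg (Finset.subset_univ _) fun _ _ _ => sq_nonneg _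

theorem IsRowLorentz.updateRow_add_smul_single {n : ℕ} {A : Matrix (Fin n) (Fin n) ℝ}
    (hA : IsRowLorentz A) (i : Fin n) {t : ℝ} (ht : 0 ≤ t) :
    IsRowLorentz (A.updateRow i (A i + t • Pi.single i 1)) := by
  intro k α
  by_cases hi : i ∈ Set.range α
  · obtain ⟨p, rfl⟩ := hi
    obtain _ | k := k
    · exact p.elim0
    simp only [minor_updateRow_add_smul]
    exact lorentz_add_smul (x := fun β => minor A α β) ht (hA _ α) (hA.updateRow_single α p)
  · simp only [minor_updateRow_of_notMem A α _ hi]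
    exact hA k α

theorem IsRowLorentz.add_smul_one {n : ℕ} {A : Matrix (Fin n) (Fin n) ℝ}
    (hA : IsRowLorentz A) {t : ℝ} (ht : 0 ≤ t) :
    IsRowLorentz (A + t • (1 : Matrix (Fin n) (Fin n) ℝ)) := by
  -- The shift is made one diagonal entry at a time, since minors are affine in a single row.
  have h : ∀ s : Finset (Fin n),
      IsRowLorentz (A + diagonal fun j => if j ∈ s then t else 0) := by
    intro s
    induction s using Finset.induction_on with
    | empty => simpa using hA
    | insert i s hi ih =>
      convert ih.updateRow_add_smul_single i ht using 1
      ext a b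
      by_cases ha : a = i
      · subst ha
        by_cases hb : a = b
        · subst hb
          simp [hi]
        · simp [hb, Ne.symm hb]
      · by_cases hb : a = b
        · subst hb
          simp [updateRow_apply, ha]
        · simp [updateRow_apply, ha, hb]
  simpa [smul_one_eq_diagonal] using h Finset.univ

end Shift

/-! ### Characteristic polynomials and stability -/

section Stability

open Classical in
theorem charpoly_coeff_eq_sum_minor {n : ℕ} (M : Matrix (Fin n) (Fin n) ℝ) {k : ℕ}
    (hk : k ≤ n) :
    M.charpoly.coeff (n - k) = (-1) ^ k * ∑ α : Fin k ↪o Fin n, minor M α α := by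
  have h := charpoly_coeff_eq_sum_minors M k (by simpa using hk)
  rw [Fintype.card_fin] at h
  rw [h]
  congr 1
  symm
  refine Finset.sum_bij (fun α _ => Finset.univ.map α.toEmbedding) ?_ ?_ ?_ ?_
  · intro α _
    simp [Finset.mem_powersetCard]
  · intro α _ β _ hαβ
    rw [← OrderEmbedding.range_inj]
    simpa using congrArg (fun s : Finset (Fin n) => (s : Set (Fin n))) hαβ
  · intro s hs
    refine ⟨s.orderEmbOfFin (Finset.mem_powersetCard.1 hs).2, Finset.mem_univ _, ?_⟩
    simp
  · intro α _
    let e : Fin k ≃ (Finset.univ.map α.toEmbedding : Finset (Fin n)) :=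
      Equiv.ofBijective (fun i => ⟨α i, by simp⟩)
        ⟨fun i j hij => α.injective (by simpa using hij), fun ⟨x, hx⟩ => by
          obtain ⟨i, -, rfl⟩ := Finset.mem_map.1 hx
          exact ⟨i, rfl⟩⟩
    rw [← det_submatrix_equiv_self e]
    rfl

/-- Up to the factor `(-1) ^ n`, the value is a polynomial in `s` with positive coefficients; the
constant term, the order `n` minor, keeps it nonzero at `s = 0`. -/
theorem IsQMatrix.eval_charpoly_neg_ne_zero {n : ℕ} {M : Matrix (Fin n) (Fin n) ℝ}
    (hM : IsQMatrix M) {s : ℝ} (hs : 0 ≤ s) : M.charpoly.eval (-s) ≠ 0 := by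
  classical
  have hpos : ∀ k ≤ n, 0 < ∑ α : Fin k ↪o Fin n, minor M α α := by
    intro k hk
    rcases Nat.eq_zero_or_pos k with rfl | hk0
    · exact Finset.sum_pos (fun α _ => by simp [minor_fin_zero])
        ⟨Fin.castLEOrderEmb hk, Finset.mem_univ _⟩
    · exact hM k hk0 hk
  have heval : M.charpoly.eval (-s) = (-1) ^ n *
      ∑ k ∈ Finset.range (n + 1), (∑ α : Fin k ↪o Fin n, minor M α α) * s ^ (n - k) := by
    rw [Polynomial.eval_eq_sum_range, charpoly_natDegree_eq_dim, Fintype.card_fin,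
      ← Finset.sum_range_reflect, Finset.mul_sum]
    refine Finset.sum_congr rfl fun k hk => ?_
    have hk' : k ≤ n := Nat.lt_succ_iff.1 (Finset.mem_range.1 hk)
    rw [show n + 1 - 1 - k = n - k by omega, charpoly_coeff_eq_sum_minor M hk', neg_pow s]
    have : (-1 : ℝ) ^ n = (-1) ^ k * (-1) ^ (n - k) := by
      rw [← pow_add, Nat.add_sub_cancel' hk']
    rw [this]
    ring
  rw [heval]
  refine mul_ne_zero (by simp) (ne_of_gt ?_)
  rw [Finset.sum_range_succ, Nat.sub_self, pow_zero, mul_one]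
  refine add_pos_of_nonneg_of_pos (Finset.sum_nonneg fun k hk => ?_) (hpos n le_rfl)
  exact mul_nonneg (hpos k (Finset.mem_range.1 hk).le).le (pow_nonneg hs _)

/-- If the square of `B` is a `Q`-matrix, then `B` has no purely imaginary eigenvalue. -/
theorem IsQMatrix.det_ne_zero_of_sq {n : ℕ} {B : Matrix (Fin n) (Fin n) ℝ}
    (hB : IsQMatrix (B ^ 2)) (y : ℝ) :
    (scalar (Fin n) (y * Complex.I) - B.map Complex.ofReal).det ≠ 0 := by
  intro h
  apply hB.eval_charpoly_neg_ne_zero (sq_nonneg y)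
  have hmap : (B ^ 2).map Complex.ofReal = B.map Complex.ofReal ^ 2 :=
    Matrix.map_pow B Complex.ofRealHom 2
  have hmul : (scalar (Fin n) (y * Complex.I) - B.map Complex.ofReal)
      * (scalar (Fin n) (y * Complex.I) + B.map Complex.ofReal)
      = scalar (Fin n) (((-(y ^ 2) : ℝ)) : ℂ) - (B ^ 2).map Complex.ofReal := by
    have hc : Commute (scalar (Fin n) (y * Complex.I)) (B.map Complex.ofReal) :=
      scalar_commute _ (fun r => Commute.all _ _) _
    rw [hmap, ← hc.mul_self_sub_mul_self_eq', ← pow_two, ← pow_two, ← map_pow]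
    congr 2
    push_cast
    rw [mul_pow, Complex.I_sq]
    ring
  have h0 : ((B ^ 2).map Complex.ofReal).charpoly.eval (((-(y ^ 2) : ℝ)) : ℂ) = 0 := by
    rw [eval_charpoly, ← hmul, det_mul, h, zero_mul]
  have h1 : ((B ^ 2).map Complex.ofReal).charpoly = (B ^ 2).charpoly.map Complex.ofRealHom :=
    charpoly_map (B ^ 2) Complex.ofRealHom
  rw [h1] at h0
  have h2 := Polynomial.eval_map_apply Complex.ofRealHom (p := (B ^ 2).charpoly) (-(y ^ 2))
  exact Complex.ofReal_eq_zero.1 (h2.symm.trans h0)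

theorem IsRowLorentz.isPositivelyStable {n : ℕ} {A : Matrix (Fin n) (Fin n) ℝ}
    (hA : IsRowLorentz A) : IsPositivelyStable A := by
  intro z hz
  by_contra! hre
  rw [Module.End.hasEigenvalue_iff_isRoot_charpoly, charpoly_toLin', Polynomial.IsRoot,
    eval_charpoly] at hz
  -- Shifting by `-z.re` moves the eigenvalue `z` to `z.im * I`.
  apply (hA.add_smul_one (neg_nonneg.2 hre)).isQMatrix_sq.det_ne_zero_of_sq z.im
  rw [← hz]
  congr 1
  ext i j
  by_cases hij : i = j
  · subst hij
    apply Complex.ext <;> simp [← sub_eq_add_neg]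
  · simp [hij]

end Stability

theorem theorem5 (n : ℕ) (A : Matrix (Fin n) (Fin n) ℝ) (hP : IsPMatrix A)
    (hdom : IsStrictlyRowSquareDiagDominant A ∨ IsStrictlyColumnSquareDiagDominant A) :
    IsPositivelyStable A ∧
    (IsStrictlyRowSquareDiagDominant A →
      ∀ (m : ℕ) (α : Fin m ↪o Fin n),
        IsStrictlyRowSquareDiagDominant (principalSubmatrix A α)) ∧
    (IsStrictlyColumnSquareDiagDominant A →
      ∀ (m : ℕ) (α : Fin m ↪o Fin n),
        IsStrictlyColumnSquareDiagDominant (principalSubmatrix A α)) ∧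
    IsQ2Matrix A ∧
    (∀ (m : ℕ) (α : Fin m ↪o Fin n), IsQ2Matrix (principalSubmatrix A α)) := by
  have hrow : IsStrictlyRowSquareDiagDominant A → IsRowLorentz A :=
    fun h => isRowLorentz_iff.2 ⟨hP, h⟩
  have hcol : IsStrictlyColumnSquareDiagDominant A → IsRowLorentz Aᵀ :=
    fun h => isRowLorentz_iff.2 ⟨hP.transpose, h⟩
  refine ⟨?_, fun h m α => (isRowLorentz_iff.1 ((hrow h).principalSubmatrix α)).2,
    fun h m α => (isRowLorentz_iff.1 ((hcol h).principalSubmatrix α)).2, ?_, fun m α => ?_⟩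
  · exact hdom.elim (fun h => (hrow h).isPositivelyStable)
      fun h => isPositivelyStable_transpose.1 (hcol h).isPositivelyStable
  · exact hdom.elim (fun h => (hrow h).isQ2Matrix)
      fun h => isQ2Matrix_transpose.1 (hcol h).isQ2Matrix
  · exact hdom.elim (fun h => ((hrow h).principalSubmatrix α).isQ2Matrix)
      fun h => isQ2Matrix_transpose.1 ((hcol h).principalSubmatrix α).isQ2Matrix
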